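/- \textbf{Lemma.} Let $\mathcal F=(F,<,+,\cdot,0,1,\ldots)$ be an expansion of an ordered field that is \emph{definably complete} (every definable subset of $F$ has a supremum and an infimum in $F\cup\{\pm\infty\}$) and \emph{locally o-minimal} (for every definable $S\subseteq F$ and every $a\in F$ there is an open interval $I\ni a$ such that $S\cap I$ is a finite union of points and open intervals). Here ``definable'' means definable in $\mathcal F$ with parameters, $F$ carries the order topology, $F^k$ the product topology, and subsets of $F^k$ the relative topology. A set $S\subseteq F^k$ is bounded if there is $N\in F$ with $|x_i|\le N$ for all $x\in S$ and $1\le i\le k$. For a definable set $A\subseteq F^k$, a \emph{definable curve} $\gamma:(0,\varepsilon)\to A$ (with $\varepsilon\in F$, $\varepsilon>0$) is a definable continuous map; it is \emph{completable in $A$} if $\lim_{t\to 0}\gamma(t)$ exists and belongs to $A$. For definable sets $A\subseteq F^k$ and $B\subseteq F^l$, a definable continuous map $f:A\to B$ is \emph{definably proper} if for every definable closed bounded subset $C$ of $F^l$ with $C\subseteq B$ the set $f^{-1}(C)$ is closed and bounded in $F^k$. Let $X\subseteq F^m$ and $Y\subseteq F^n$ be definable sets, let $Z\subseteq Y\times X$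 be a definable set, and let $p_1:Z\to Y$ and $p_2:Z\to X$ be the restrictions of the canonical projections. Suppose that: \begin{enumerate} \item[(1)] The map $p_1$ is surjective. \item[(2)] For any $y_1,y_2\in Y$, either $p_2(p_1^{-1}(y_1))=p_2(p_1^{-1}(y_2))$ or $p_2(p_1^{-1}(y_1))\cap p_2(p_1^{-1}(y_2))=\emptyset$. \item[(3)] $X$ is closed in $F^m$, and $Z$ is closed in $Y\times X$. \item[(4)] For any definable curve $\gamma:(0,\varepsilon)\to Y$ completable in $Y$, there exists a definable curve $\alpha:(0,\delta)\to Z$ completable in $Z$ such that $0<\delta\le\varepsilon$ and $p_1\circ\alpha=\gamma|_{(0,\delta)}$. \item[(5)] For any definable curve $\beta:(0,\varepsilon)\to X$ completable in $X$, with $x=\lim_{t\to 0}\beta(t)\in X$, and any $y\in Y$ with $(y,x)\in Z$, there exists a definable curve $\alpha:(0,\delta)\to Z$ completable in $Z$ such that $0<\delta\le\varepsilon$, $p_2\circ\alpha=\beta|_{(0,\delta)}$ and $\lim_{t\to 0}\alpha(t)=(y,x)$. \end{enumerate} Then there exists a definable closed subset $K$ of $X$ such that the map $p_1|_{p_2^{-1}(K)}:p_2^{-1}(K)\to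 Y$ is surjective and definably proper. -/

import Mathlib

open Set Filter Topology

universe u v w

namespace LocOMin

/-- Definable with arbitrary parameters from the universe `F` of the structure. -/
def Def (L : FirstOrder.Language.{u, v}) {F : Type w} [L.Structure F] {ι : Type*}
    (S : Set (ι → F)) : Prop :=
  (univ : Set F).Definable L S

/-- The `L`-structure on `F` expands the ordered field `F`: the order and the graphs of addition
and multiplication are definable. (In particular this holds if `L` has symbols that are
interpreted as the order, the addition and the multiplication of `F`.) -/
structure ExpandsOrderedField (L : FirstOrder.Language.{u, v}) (F : Type w) [Field F]
    [LinearOrder F] [L.Structure F] : Prop where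
  def_lt : Def L {v : Fin 2 → F | v 0 < v 1}
  def_add : Def L {v : Fin 3 → F | v 0 + v 1 = v 2}
  def_mul : Def L {v : Fin 3 → F | v 0 * v 1 = v 2}

/-- Every definable subset of `F` has a supremum and an infimum in `F ∪ {±∞}`. As `F` has no
endpoints, this only has content for nonempty sets that are bounded on the relevant side. -/
structure DefinablyComplete (L : FirstOrder.Language.{u, v}) (F : Type w) [LinearOrder F]
    [L.Structure F] : Prop where
  exists_sup : ∀ S : Set F, (univ : Set F).Definable₁ L S → S.Nonempty → BddAbove S →
    ∃ s, IsLUB S s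
  exists_inf : ∀ S : Set F, (univ : Set F).Definable₁ L S → S.Nonempty → BddBelow S →
    ∃ s, IsGLB S s

/-- Around every point of `F`, every definable subset of `F` is a finite union of points and
open intervals. -/
def LocallyOMinimal (L : FirstOrder.Language.{u, v}) (F : Type w) [LinearOrder F]
    [L.Structure F] : Prop :=
  ∀ S : Set F, (univ : Set F).Definable₁ L S → ∀ a : F, ∃ c d : F, c < a ∧ a < d ∧
    ∃ (P : Finset F) (Q : Finset (F × F)),
      S ∩ Ioo c d = (P : Set F) ∪ ⋃ q ∈ Q, Ioo q.1 q.2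

/-- A subset of a Cartesian power of `F` is bounded if it is contained in a box. -/
def Bdd {F : Type w} [Field F] [LinearOrder F] {ι : Type*} (S : Set (ι → F)) : Prop :=
  ∃ N : F, ∀ x ∈ S, ∀ i, |x i| ≤ N

/-- `A` is a subset of `B` which is closed in the relative topology of `B`. -/
def ClosedIn {T : Type*} [TopologicalSpace T] (A B : Set T) : Prop :=
  ∃ C : Set T, IsClosed C ∧ A = B ∩ C

/-- The product `A × B`, as a subset of `F ^ (ι ⊕ κ)`, which is `F ^ ι × F ^ κ`. -/
def prodSet {F : Type w} {ι κ : Type*} (A : Set (ι → F)) (B : Set (κ → F)) :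
    Set (ι ⊕ κ → F) :=
  {z | z ∘ Sum.inl ∈ A ∧ z ∘ Sum.inr ∈ B}

/-- The projection of `F ^ ι × F ^ κ` to the first factor. -/
def proj₁ {F : Type w} {ι κ : Type*} (z : ι ⊕ κ → F) : ι → F := z ∘ Sum.inl

/-- The projection of `F ^ ι × F ^ κ` to the second factor. -/
def proj₂ {F : Type w} {ι κ : Type*} (z : ι ⊕ κ → F) : κ → F := z ∘ Sum.inr

/-- The restriction of `f` to `A` is a definable map from `A` to `B`
(that is, its graph is definable). -/
structure DefMap (L : FirstOrder.Language.{u, v}) {F : Type w} [L.Structure F] {ι κ : Type*}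
    (A : Set (ι → F)) (B : Set (κ → F)) (f : (ι → F) → κ → F) : Prop where
  mapsTo : MapsTo f A B
  def_graph : Def L {z : ι ⊕ κ → F | proj₁ z ∈ A ∧ proj₂ z = f (proj₁ z)}

/-- The restriction of `γ` to `(0, ε)` is a definable curve `(0, ε) → A`. The values of `γ` outside
`(0, ε)` are irrelevant. -/
structure DefCurve (L : FirstOrder.Language.{u, v}) {F : Type w} [Field F] [LinearOrder F]
    [TopologicalSpace F] [L.Structure F] {ι : Type*}
    (A : Set (ι → F)) (ε : F) (γ : F → ι → F) : Prop where
  pos : 0 < ε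
  mapsTo : MapsTo γ (Ioo 0 ε) A
  continuousOn : ContinuousOn γ (Ioo 0 ε)
  def_graph : Def L {z : Unit ⊕ ι → F |
    z (Sum.inl ()) ∈ Ioo 0 ε ∧ proj₂ z = γ (z (Sum.inl ()))}

/-- `lim_{t → 0} γ(t) = x` for a curve `γ` that is defined on an interval `(0, ε)`. -/
def CurveLim {F : Type w} [Field F] [LinearOrder F] [TopologicalSpace F] {ι : Type*}
    (γ : F → ι → F) (x : ι → F) : Prop :=
  Tendsto γ (𝓝[>] 0) (𝓝 x)

/-- The curve `γ` is completable in `A`. -/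
def Completable {F : Type w} [Field F] [LinearOrder F] [TopologicalSpace F] {ι : Type*}
    (A : Set (ι → F)) (γ : F → ι → F) : Prop :=
  ∃ x ∈ A, CurveLim γ x

/-- The restriction of `f` to `A` is a definably proper map from `A` to `B`: it is definable and
continuous, and the inverse image of every closed bounded definable set contained in `B` is
closed and bounded. -/
structure DefProper (L : FirstOrder.Language.{u, v}) {F : Type w} [Field F] [LinearOrder F]
    [TopologicalSpace F] [L.Structure F] {ι κ : Type*}
    (A : Set (ι → F)) (B : Set (κ → F)) (f : (ι → F) → κ → F) : Prop where
  defMap : DefMap L A B f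
  continuousOn : ContinuousOn f A
  proper : ∀ C : Set (κ → F), Def L C → IsClosed C → Bdd C → C ⊆ B →
    IsClosed (A ∩ f ⁻¹' C) ∧ Bdd (A ∩ f ⁻¹' C)

end LocOMin

/-! Take `K` to be the closure of `nearlyMinimal Z`, the points whose norm is within `1` of the
infimum over some fibre of `Z` containing them. Every nonempty fibre has such a point, so `K` meets
all fibres. Over a closed `C ⊆ Y`, closedness of the preimage follows from (3).

Boundedness is the real content. Suppose the part of `Z` over a bounded closed `C` with second
coordinate in `K` is unbounded. Let `(y, x)` be such a point with `x` far out. A curve of nearly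
minimal points tends to `x`; (5) lifts it to a curve in `Z` tending to `(y, x)`. By (2) the fibre
over a nearby point `y'` of the lift is the fibre in which the point of the curve is nearly minimal,
so all of it is far out (`exists_fibre_far_out`). Hence arbitrarily near `C` there are points of `Y`
whose whole fibres are arbitrarily far out. Select them along a definable curve `γ`; it is bounded,
so it converges to a point of `C ⊆ Y`. By (4) it lifts to a convergent curve in `Z`, whose points
stay bounded: a contradiction.

Curve selection (`exists_curve`) combines definable choice (`exists_defFun_choice`) with continuity
of one-variable definable functions just to the right of any point (`eventually_continuousAt`);
limits come from `exists_tendsto_nhdsGT`. -/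

namespace LocOMin

/-! ### Calculus of definable sets and functions -/

section Definability

variable {L : FirstOrder.Language.{u, v}} {F : Type w} [L.Structure F]
variable {ι κ : Type*}

theorem Def.and {P Q : (ι → F) → Prop} (hP : Def L {v | P v}) (hQ : Def L {v | Q v}) :
    Def L {v | P v ∧ Q v} :=
  Set.Definable.inter hP hQ

theorem Def.or {P Q : (ι → F) → Prop} (hP : Def L {v | P v}) (hQ : Def L {v | Q v}) :
    Def L {v | P v ∨ Q v} :=
  Set.Definable.union hP hQ

theorem Def.not {P : (ι → F) → Prop} (hP : Def L {v | P v}) : Def L {v | ¬ P v} :=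
  Set.Definable.compl hP

theorem Def.imp {P Q : (ι → F) → Prop} (hP : Def L {v | P v}) (hQ : Def L {v | Q v}) :
    Def L {v | P v → Q v} := by
  simpa only [imp_iff_not_or] using hP.not.or hQ

theorem Def.reindex {A : Set (ι → F)} (hA : Def L A) (e : ι → κ) :
    Def L {v : κ → F | (fun i => v (e i)) ∈ A} :=
  Set.Definable.preimage_comp e hA

theorem Def.exVec [Finite ι] [Finite κ] {P : (ι → F) → (κ → F) → Prop}
    (hP : Def L {v : ι ⊕ κ → F | P (fun i => v (Sum.inl i)) (fun k => v (Sum.inr k))}) :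
    Def L {v : ι → F | ∃ w : κ → F, P v w} := by
  have h := Set.Definable.image_comp hP (Sum.inl : ι → ι ⊕ κ)
  refine (congrArg (Def L) ?_).mp h
  ext v
  constructor
  · rintro ⟨z, hz, rfl⟩
    exact ⟨_, hz⟩
  · rintro ⟨w, hw⟩
    exact ⟨Sum.elim v w, hw, rfl⟩

theorem Def.allVec [Finite ι] [Finite κ] {P : (ι → F) → (κ → F) → Prop}
    (hP : Def L {v : ι ⊕ κ → F | P (fun i => v (Sum.inl i)) (fun k => v (Sum.inr k))}) :
    Def L {v : ι → F | ∀ w : κ → F, P v w} := by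
  have h := (Def.exVec (P := fun v w => ¬ P v w) hP.not).not
  simpa only [not_exists, not_not] using h

theorem Def.ex [Finite ι] {P : (ι → F) → F → Prop}
    (hP : Def L {v : Option ι → F | P (fun i => v (some i)) (v none)}) :
    Def L {v : ι → F | ∃ x : F, P v x} := by
  have h := Set.Definable.image_comp hP (some : ι → Option ι)
  refine (congrArg (Def L) ?_).mp h
  ext v
  constructor
  · rintro ⟨z, hz, rfl⟩
    exact ⟨_, hz⟩
  · rintro ⟨x, hx⟩
    exact ⟨fun o => o.elim x v, hx, rfl⟩

theorem Def.all [Finite ι] {P : (ι → F) → F → Prop}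
    (hP : Def L {v : Option ι → F | P (fun i => v (some i)) (v none)}) :
    Def L {v : ι → F | ∀ x : F, P v x} := by
  have h := (Def.ex (P := fun v x => ¬ P v x) hP.not).not
  simpa only [not_exists, not_not] using h

theorem Def.finAll [Finite κ] {P : κ → (ι → F) → Prop} (hP : ∀ k, Def L {v | P k v}) :
    Def L {v | ∀ k, P k v} := by
  have := Fintype.ofFinite κ
  have h := Set.definable_biInter_finset (A := (univ : Set F)) (L := L) hP Finset.univ
  refine (congrArg (Def L) ?_).mp h
  ext v
  simp

/-- The function `f` has a definable graph. -/
def DefFun (L : FirstOrder.Language.{u, v}) {F : Type w} [L.Structure F] {ι : Type*}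
    (f : (ι → F) → F) : Prop :=
  Def L {v : Option ι → F | v none = f (fun i => v (some i))}

theorem Def.var_eq (i j : ι) : Def L {v : ι → F | v i = v j} :=
  ⟨FirstOrder.Language.Term.equal (FirstOrder.Language.Term.var i)
    (FirstOrder.Language.Term.var j), by ext v; simp⟩

theorem Def.var_eq_const (i : ι) (c : F) : Def L {v : ι → F | v i = c} :=
  ⟨FirstOrder.Language.Term.equal (FirstOrder.Language.Term.var i)
    (FirstOrder.Language.Constants.term (L.con (⟨c, mem_univ c⟩ : (univ : Set F)))), by ext v; simp⟩

theorem DefFun.var (i : ι) : DefFun L (fun v : ι → F => v i) :=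
  Def.var_eq none (some i)

theorem DefFun.const (c : F) : DefFun L (fun _ : ι → F => c) :=
  Def.var_eq_const none c

theorem DefFun.reindex {f : (ι → F) → F} (hf : DefFun L f) (e : ι → κ) :
    DefFun L (fun v : κ → F => f (fun i => v (e i))) :=
  Def.reindex hf (fun o => o.map e)

theorem DefFun.lift {f : (ι → F) → F} (hf : DefFun L f) :
    DefFun L (fun v : Option ι → F => f (fun i => v (some i))) :=
  hf.reindex some

/-- Quantify over the vector `w` of values: `w = g v` and `w ∈ A` are both definable conditions. -/
theorem Def.subst [Finite ι] [Finite κ] {A : Set (κ → F)} (hA : Def L A)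
    {g : κ → (ι → F) → F} (hg : ∀ k, DefFun L (g k)) :
    Def L {v : ι → F | (fun k => g k v) ∈ A} := by
  have h : Def L {v : ι → F | ∃ w : κ → F, (∀ k, w k = g k v) ∧ w ∈ A} := by
    refine Def.exVec (Def.and (Def.finAll fun k => ?_) (hA.reindex Sum.inr))
    exact Def.reindex (hg k) (fun o : Option ι => o.elim (Sum.inr k) Sum.inl)
  refine (congrArg (Def L) ?_).mp h
  ext v
  constructor
  · rintro ⟨w, hw, hA⟩
    rwa [show w = fun k => g k v from funext hw] at hA
  · intro hv
    exact ⟨_, fun _ => rfl, hv⟩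

theorem Def.subst_elim {μ : Type*} [Finite ι] [Finite κ] [Finite μ] {A : Set (κ ⊕ μ → F)}
    (hA : Def L A) {g : κ → (ι → F) → F} (hg : ∀ k, DefFun L (g k)) {h : μ → (ι → F) → F}
    (hh : ∀ k, DefFun L (h k)) :
    Def L {v : ι → F | Sum.elim (fun k => g k v) (fun k => h k v) ∈ A} := by
  have := hA.subst (g := fun k => Sum.elim g h k) (by rintro (k | k); exacts [hg k, hh k])
  refine (congrArg (Def L) ?_).mp this
  ext v
  have : (fun k => Sum.elim g h k v) = Sum.elim (fun k => g k v) (fun k => h k v) := by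
    ext (k | k) <;> rfl
  simp only [mem_ofPred_eq, this]

theorem Def.app [Finite ι] [Finite κ] {P : (κ → F) → F → Prop}
    (hP : Def L {v : Option κ → F | P (fun i => v (some i)) (v none)})
    {g : κ → (ι → F) → F} (hg : ∀ k, DefFun L (g k)) {f : (ι → F) → F} (hf : DefFun L f) :
    Def L {v : ι → F | P (fun k => g k v) (f v)} :=
  hP.subst (g := fun o => o.elim f g) (by rintro (_ | k); exacts [hf, hg k])

theorem DefFun.comp [Finite ι] [Finite κ] {f : (κ → F) → F} (hf : DefFun L f)
    {g : κ → (ι → F) → F} (hg : ∀ k, DefFun L (g k)) :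
    DefFun L (fun v => f (fun k => g k v)) :=
  Def.app (P := fun w x => x = f w) hf (fun k => (hg k).lift) (DefFun.var none)

theorem DefFun.comp₁ [Finite ι] {f : F → F} (hf : DefFun L (fun v : Unit → F => f (v ())))
    {g : (ι → F) → F} (hg : DefFun L g) : DefFun L (fun v => f (g v)) :=
  hf.comp (fun _ => hg)

theorem Def.eq [Finite ι] {f g : (ι → F) → F} (hf : DefFun L f) (hg : DefFun L g) :
    Def L {v | f v = g v} :=
  Def.app (P := fun w x => x = f w) hf DefFun.var hg |> fun h => by
    simpa only [eq_comm] using h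

theorem DefFun.ite [Finite ι] {P : (ι → F) → Prop} [DecidablePred P] (hP : Def L {v | P v})
    {f g : (ι → F) → F} (hf : DefFun L f) (hg : DefFun L g) :
    DefFun L (fun v => if P v then f v else g v) := by
  have h := ((hP.reindex (κ := Option ι) some).and hf).or
    ((hP.reindex (κ := Option ι) some).not.and hg)
  refine (congrArg (Def L) ?_).mp h
  ext v
  by_cases hv : P (fun i => v (some i)) <;> simp [hv]

theorem Def.definable₁ {P : F → Prop} (hP : Def L {v : Unit → F | P (v ())}) :
    (univ : Set F).Definable₁ L {x | P x} :=
  Def.reindex hP (fun _ => (0 : Fin 1))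

theorem Def.app₂ {ι : Type*} [Finite ι] {P : F → F → Prop}
    (hP : Def L {v : Fin 2 → F | P (v 0) (v 1)})
    {f g : (ι → F) → F} (hf : DefFun L f) (hg : DefFun L g) : Def L {v | P (f v) (g v)} :=
  hP.subst (g := ![f, g]) (by intro k; fin_cases k; exacts [hf, hg])

open Classical in
theorem exists_defFun_of_functional [Zero F] [Finite ι] {R : (ι → F) → F → Prop}
    (hR : Def L {v : Option ι → F | R (fun i => v (some i)) (v none)})
    (huniq : ∀ v x x', R v x → R v x' → x = x') :
    ∃ c : (ι → F) → F, DefFun L c ∧ ∀ v x, R v x → c v = x := by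
  refine ⟨fun v => if h : ∃ x, R v x then h.choose else 0, ?_, fun v x hx => ?_⟩
  · have hex : Def L {v : Option ι → F | ∃ x, R (fun i => v (some i)) x} :=
      (Def.ex hR).reindex some
    refine (congrArg (Def L) ?_).mp
      (hR.or (hex.not.and (Def.eq (DefFun.var none) (DefFun.const 0))))
    ext v
    by_cases h : ∃ x, R (fun i => v (some i)) x
    · have hn : R (fun i => v (some i)) (v none) ↔ v none = h.choose :=
        ⟨fun hv => huniq _ _ _ hv h.choose_spec, fun hv => hv ▸ h.choose_spec⟩
      simp only [mem_ofPred_eq, h, not_true_eq_false, false_and, or_false, dif_pos, hn]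
    · have hn : ¬ R (fun i => v (some i)) (v none) := fun hv => h ⟨_, hv⟩
      simp only [mem_ofPred_eq, h, hn, not_false_eq_true, true_and, false_or, dif_neg]
  · have h : ∃ x, R v x := ⟨x, hx⟩
    simp only [h, dif_pos]
    exact huniq _ _ _ h.choose_spec hx

end Definability

/-! ### Definability of the ordered field operations -/

section Field

variable {L : FirstOrder.Language.{u, v}} {F : Type w} [Field F] [LinearOrder F]
  [L.Structure F]
variable {ι : Type*} [Finite ι] {f g : (ι → F) → F}

theorem Def.lt (hF : ExpandsOrderedField L F) (hf : DefFun L f) (hg : DefFun L g) : Def L {v | f v < g v} :=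
  hF.def_lt.subst (g := ![f, g]) (by intro k; fin_cases k; exacts [hf, hg])

theorem Def.le (hF : ExpandsOrderedField L F) (hf : DefFun L f) (hg : DefFun L g) : Def L {v | f v ≤ g v} := by
  simpa only [not_lt] using (Def.lt hF hg hf).not

theorem DefFun.add (hF : ExpandsOrderedField L F) (hf : DefFun L f) (hg : DefFun L g) : DefFun L (fun v => f v + g v) := by
  have h := hF.def_add.subst (ι := Option ι)
    (g := ![fun v => f (fun i => v (some i)), fun v => g (fun i => v (some i)), fun v => v none])
    (by intro k; fin_cases k; exacts [hf.lift, hg.lift, DefFun.var none])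
  refine (congrArg (Def L) ?_).mp h
  ext v
  exact eq_comm

theorem DefFun.mul (hF : ExpandsOrderedField L F) (hf : DefFun L f) (hg : DefFun L g) : DefFun L (fun v => f v * g v) := by
  have h := hF.def_mul.subst (ι := Option ι)
    (g := ![fun v => f (fun i => v (some i)), fun v => g (fun i => v (some i)), fun v => v none])
    (by intro k; fin_cases k; exacts [hf.lift, hg.lift, DefFun.var none])
  refine (congrArg (Def L) ?_).mp h
  ext v
  exact eq_comm

theorem DefFun.neg (hF : ExpandsOrderedField L F) (hf : DefFun L f) : DefFun L (fun v => - f v) := by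
  simpa using DefFun.mul hF (DefFun.const (-1)) hf

theorem DefFun.sub (hF : ExpandsOrderedField L F) (hf : DefFun L f) (hg : DefFun L g) : DefFun L (fun v => f v - g v) := by
  simpa only [sub_eq_add_neg] using DefFun.add hF hf (DefFun.neg hF hg)

theorem DefFun.inv (hF : ExpandsOrderedField L F) (hf : DefFun L f) : DefFun L (fun v => (f v)⁻¹) := by
  -- The first disjunct accounts for the convention `0⁻¹ = 0`.
  have h := ((Def.eq hf.lift (DefFun.const 0)).and (Def.eq (DefFun.var none) (DefFun.const 0))).or
    (Def.eq (DefFun.mul hF hf.lift (DefFun.var none)) (DefFun.const 1))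
  refine (congrArg (Def L) ?_).mp h
  ext v
  simp only [mem_ofPred_eq]
  constructor
  · rintro (⟨h0, h1⟩ | h1)
    · simp [h0, h1]
    · exact eq_inv_of_mul_eq_one_right h1
  · intro hv
    by_cases h0 : f (fun i => v (some i)) = 0
    · left
      simp [hv, h0]
    · right
      rw [hv, mul_inv_cancel₀ h0]

theorem DefFun.abs [IsStrictOrderedRing F] (hF : ExpandsOrderedField L F) (hf : DefFun L f) : DefFun L (fun v => |f v|) := by
  simp only [abs_eq_max_neg, max_def]
  exact DefFun.ite (Def.le hF hf (DefFun.neg hF hf)) (DefFun.neg hF hf) hf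

end Field

/-! ### The one-sided dichotomy from local o-minimality -/

section Order

variable {L : FirstOrder.Language.{u, v}} {F : Type w} [LinearOrder F] [L.Structure F]
  [TopologicalSpace F] [OrderTopology F]

theorem eventually_mem_Ioo {a b : F} (h : a < b) : ∀ᶠ t in 𝓝[>] a, t ∈ Ioo a b :=
  Ioo_mem_nhdsGT h

/-- Either one of the finitely many intervals has left end `≤ a` and right end `> a`, and then it
covers a right neighbourhood of `a`, or every point and every interval misses such a neighbourhood.
-/
theorem eventually_mem_or_notMem (homin : LocallyOMinimal L F) {S : Set F}
    (hS : (univ : Set F).Definable₁ L S) (a : F) :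
    (∀ᶠ t in 𝓝[>] a, t ∈ S) ∨ (∀ᶠ t in 𝓝[>] a, t ∉ S) := by
  obtain ⟨c, d, hca, had, P, Q, h⟩ := homin S hS a
  have key : (∀ᶠ t in 𝓝[>] a, t ∈ ((P : Set F) ∪ ⋃ q ∈ Q, Ioo q.1 q.2)) ∨
      (∀ᶠ t in 𝓝[>] a, t ∉ ((P : Set F) ∪ ⋃ q ∈ Q, Ioo q.1 q.2)) := by
    by_cases hq : ∃ q ∈ Q, q.1 ≤ a ∧ a < q.2
    · obtain ⟨q, hqQ, h1, h2⟩ := hq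
      left
      filter_upwards [Ioo_mem_nhdsGT h2] with t ht
      exact Or.inr (mem_biUnion hqQ ⟨h1.trans_lt ht.1, ht.2⟩)
    · right
      have hP : ∀ᶠ t in 𝓝[>] a, t ∉ (P : Set F) := by
        by_cases haP : ∃ b, IsLeast {x ∈ P | a < x} b
        · obtain ⟨b, hb⟩ := haP
          filter_upwards [Ioo_mem_nhdsGT hb.1.2] with t ht htP
          exact absurd (hb.2 ⟨htP, ht.1⟩) (not_le.mpr ht.2)
        · filter_upwards [self_mem_nhdsWithin] with t ht htP
          apply haP
          have hne : (P.filter (a < ·)).Nonempty := ⟨t, by simpa using ⟨htP, ht⟩⟩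
          exact ⟨_, by simpa using (P.filter (a < ·)).isLeast_min' hne⟩
      have hQ : ∀ᶠ t in 𝓝[>] a, ∀ q ∈ Q, t ∉ Ioo q.1 q.2 := by
        rw [Filter.eventually_all_finset]
        intro q hqQ
        push Not at hq
        by_cases h1 : q.1 ≤ a
        · filter_upwards [self_mem_nhdsWithin] with t ht htq
          exact absurd (htq.2.trans_le (hq q hqQ h1)) (not_lt.mpr (le_of_lt ht))
        · filter_upwards [Ioo_mem_nhdsGT (not_le.mp h1)] with t ht htq
          exact lt_asymm ht.2 htq.1
      filter_upwards [hP, hQ] with t h1 h2 h3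
      rcases h3 with h3 | h3
      · exact h1 h3
      · simp only [mem_iUnion] at h3
        obtain ⟨q, hqQ, h3⟩ := h3
        exact h2 q hqQ h3
  rw [← h] at key
  refine key.imp (fun hk => hk.mono fun t ht => ht.1) fun hk => ?_
  filter_upwards [hk, Ioo_mem_nhdsGT had] with t ht htd hS'
  exact ht ⟨hS', hca.trans htd.1, htd.2⟩

theorem eventually_or_not (homin : LocallyOMinimal L F) {P : F → Prop}
    (hP : Def L {v : Unit → F | P (v ())}) (a : F) :
    (∀ᶠ t in 𝓝[>] a, P t) ∨ (∀ᶠ t in 𝓝[>] a, ¬ P t) :=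
  eventually_mem_or_notMem homin hP.definable₁ a

end Order

/-! ### Definable infima, one-sided limits, continuity and definable choice -/

section DefinablyComplete

variable {L : FirstOrder.Language.{u, v}} {F : Type w} [Field F] [LinearOrder F] [L.Structure F]

section Choice

variable {ι : Type*} [Finite ι]

theorem exists_defFun_isGLB (hF : ExpandsOrderedField L F) (hc : DefinablyComplete L F)
    {Q : (ι → F) → F → Prop}
    (hQ : Def L {v : Option ι → F | Q (fun i => v (some i)) (v none)}) :
    ∃ c : (ι → F) → F, DefFun L c ∧
      ∀ v, (∃ x, Q v x) → BddBelow {x | Q v x} → IsGLB {x | Q v x} (c v) := by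
  obtain ⟨c, hc1, hc2⟩ := exists_defFun_of_functional (L := L)
    (R := fun v a => (∀ x, Q v x → a ≤ x) ∧ ∀ b, (∀ x, Q v x → b ≤ x) → b ≤ a)
    (by
      refine Def.and (Def.all (Def.imp ?_ (Def.le hF (DefFun.var _) (DefFun.var _))))
        (Def.all (Def.imp (Def.all (Def.imp ?_ (Def.le hF (DefFun.var _) (DefFun.var _))))
          (Def.le hF (DefFun.var _) (DefFun.var _))))
      · exact Def.app hQ (fun k => DefFun.var _) (DefFun.var _)
      · exact Def.app hQ (fun k => DefFun.var _) (DefFun.var _))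
    (fun v x x' hx hx' => le_antisymm (hx'.2 _ hx.1) (hx.2 _ hx'.1))
  refine ⟨c, hc1, fun v hne hbdd => ?_⟩
  have hd : (univ : Set F).Definable₁ L {x | Q v x} :=
    Def.definable₁ (Def.app hQ (fun k => DefFun.const (v k)) (DefFun.var _))
  obtain ⟨a, ha⟩ := hc.exists_inf _ hd hne hbdd
  have : c v = a := hc2 v a ⟨fun x hx => ha.1 hx, fun b hb => ha.2 hb⟩
  rwa [this]

end Choice

section Topology

variable [IsStrictOrderedRing F] [TopologicalSpace F] [OrderTopology F]

theorem eventually_nhdsGT_iff {p : F} {P : F → Prop} :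
    (∀ᶠ t in 𝓝[>] p, P t) ↔ ∃ b, p < b ∧ ∀ t, p < t → t < b → P t := by
  rw [Filter.Eventually, mem_nhdsGT_iff_exists_Ioo_subset]
  exact ⟨fun ⟨b, hb, h⟩ => ⟨b, hb, fun t h1 h2 => h ⟨h1, h2⟩⟩,
    fun ⟨b, hb, h⟩ => ⟨b, hb, fun t ht => h t ht.1 ht.2⟩⟩

/-- The limit is the supremum of the `c` with `c ≤ f` just to the right of `p`. For `a` above it, `a
≤ f` fails to hold eventually, so by the dichotomy `f < a` eventually. -/
theorem exists_tendsto_nhdsGT (hF : ExpandsOrderedField L F) (hc : DefinablyComplete L F)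
    (homin : LocallyOMinimal L F) {f : F → F} (hf : DefFun L (fun v : Unit → F => f (v ())))
    {p N : F} (hN : ∀ᶠ t in 𝓝[>] p, |f t| ≤ N) : ∃ l, Tendsto f (𝓝[>] p) (𝓝 l) := by
  have hS : Def L {v : Unit → F | ∃ b, p < b ∧ ∀ t, p < t → t < b → v () ≤ f t} := by
    refine Def.ex (Def.and (Def.lt hF (DefFun.const _) (DefFun.var _)) (Def.all (Def.imp
      (Def.lt hF (DefFun.const _) (DefFun.var _)) (Def.imp
      (Def.lt hF (DefFun.var _) (DefFun.var _))
      (Def.le hF (DefFun.var _) (hf.comp₁ (DefFun.var _)))))))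
  obtain ⟨l, hl⟩ := hc.exists_sup _
    (Def.definable₁ (P := fun c => ∃ b, p < b ∧ ∀ t, p < t → t < b → c ≤ f t) hS)
    ⟨-N, eventually_nhdsGT_iff.mp (hN.mono fun t ht => (abs_le.mp ht).1)⟩
    ⟨N, fun c hcS => by
      obtain ⟨t, h1, h2⟩ := (hN.and (eventually_nhdsGT_iff.mpr hcS)).exists
      exact h2.trans (abs_le.mp h1).2⟩
  simp only [← eventually_nhdsGT_iff] at hl
  refine ⟨l, tendsto_order.mpr ⟨fun a ha => ?_, fun a ha => ?_⟩⟩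
  · obtain ⟨c, hc1, hc2⟩ := (lt_isLUB_iff hl).mp ha
    exact (show ∀ᶠ t in 𝓝[>] p, c ≤ f t from hc1).mono fun t ht => hc2.trans_le ht
  · refine ((eventually_or_not homin (P := fun t => a ≤ f t)
      (Def.le hF (DefFun.const _) hf) p).resolve_left fun h => ?_).mono fun t ht => not_le.mp ht
    exact absurd (hl.1 h) (not_le.mpr ha)

/-- A decreasing definable family of sets, none of which accumulates from the right at a point,
does not cover an interval. -/
theorem not_forall_exists_of_not_accumulating (hF : ExpandsOrderedField L F)
    (hc : DefinablyComplete L F) (homin : LocallyOMinimal L F) {E : F → F → Prop}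
    (hE : Def L {v : Fin 2 → F | E (v 0) (v 1)})
    (hanti : ∀ s s' t, 0 < s → s ≤ s' → E s' t → E s t) {c d : F} (hcd : c < d)
    (hacc : ∀ s, 0 < s → ∀ p ∈ Ico c d, ∀ᶠ t in 𝓝[>] p, ¬ E s t) :
    ¬ ∀ t ∈ Ioo c d, ∃ s, 0 < s ∧ E s t := by
  intro hcov
  -- Call `x` a record if it lies in every `E s` that meets `(c, x)`. Records turn out to exist
  -- arbitrarily close to `c`, so by the dichotomy all points just right of `c` are records.
  let R : F → Prop := fun x => ∀ u, c < u → u < x → ∀ s, 0 < s → E s u → E s x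
  have hR : Def L {v : Unit → F | R (v ())} := by
    refine Def.all (Def.imp (Def.lt hF (DefFun.const _) (DefFun.var _)) (Def.imp
      (Def.lt hF (DefFun.var _) (DefFun.var _)) (Def.all (Def.imp
      (Def.lt hF (DefFun.const _) (DefFun.var _)) (Def.imp ?_ ?_)))))
    · exact Def.app₂ hE (DefFun.var _) (DefFun.var _)
    · exact Def.app₂ hE (DefFun.var _) (DefFun.var _)
  have hrec : ∀ x ∈ Ioo c d, ∃ p ∈ Ioc c x, R p := by
    intro x hx
    obtain ⟨s, hs, hsx⟩ := hcov x hx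
    have hT : Def L {v : Unit → F | c < v () ∧ v () ≤ x ∧ E s (v ())} :=
      Def.and (Def.lt hF (DefFun.const _) (DefFun.var _)) (Def.and
        (Def.le hF (DefFun.var _) (DefFun.const _))
        (Def.app₂ hE (DefFun.const _) (DefFun.var _)))
    obtain ⟨p, hp⟩ := hc.exists_inf _ (Def.definable₁ (P := fun t => c < t ∧ t ≤ x ∧ E s t) hT)
      ⟨x, hx.1, le_rfl, hsx⟩ ⟨c, fun t ht => ht.1.le⟩
    have hcp : c ≤ p := hp.2 fun t ht => ht.1.le
    have hpx : p ≤ x := hp.1 ⟨hx.1, le_rfl, hsx⟩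
    -- The infimum of `E s ∩ (c, x]` is attained, since `E s` does not accumulate at it from the
    -- right; the least element is a record.
    have hpT : c < p ∧ p ≤ x ∧ E s p := by
      by_contra hpT
      obtain ⟨b, hb, hb'⟩ := eventually_nhdsGT_iff.mp
        (hacc s hs p ⟨hcp, hpx.trans_lt hx.2⟩)
      obtain ⟨t, ht, htb⟩ := (isGLB_lt_iff hp).mp hb
      rcases (hp.1 ht).lt_or_eq with h | h
      · exact hb' t h htb ht.2.2
      · exact hpT (h ▸ ht)
    refine ⟨p, ⟨hpT.1, hpx⟩, fun u hcu hup s' hs' hu => ?_⟩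
    have hnu : ¬ E s u := fun h => not_le.mpr hup (hp.1 ⟨hcu, hup.le.trans hpx, h⟩)
    have : s' ≤ s := by
      by_contra hlt
      exact hnu (hanti _ _ _ hs (not_le.mp hlt).le hu)
    exact hanti _ _ _ hs' this hpT.2.2
  rcases eventually_or_not homin hR c with h | h
  · obtain ⟨b, hb, hb'⟩ := eventually_nhdsGT_iff.mp h
    obtain ⟨x, hx1, hx2⟩ := exists_between (lt_min hb hcd)
    have hxd := hx2.trans_le (min_le_right _ _)
    obtain ⟨s, hs, hsx⟩ := hcov x ⟨hx1, hxd⟩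
    -- If all points near `c` are records, then `x ∈ E s` forces all slightly larger points into `E
    -- s`, which therefore accumulates at `x`.
    obtain ⟨t, ht, htx, htb⟩ := ((hacc s hs x ⟨hx1.le, hxd⟩).and
      (Ioo_mem_nhdsGT (hx2.trans_le (min_le_left _ _)))).exists
    exact ht (hb' t (hx1.trans htx) htb x hx1 htx s hs hsx)
  · obtain ⟨b, hb, hb'⟩ := eventually_nhdsGT_iff.mp h
    obtain ⟨x, hx1, hx2⟩ := exists_between (lt_min hb hcd)
    obtain ⟨p, hp, hRp⟩ := hrec x ⟨hx1, hx2.trans_le (min_le_right _ _)⟩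
    exact hb' p hp.1 (hp.2.trans_lt (hx2.trans_le (min_le_left _ _))) hRp

theorem continuousAt_iff_forall_abs {f : F → F} {t : F} :
    ContinuousAt f t ↔
      ∀ s, 0 < s → ∃ δ, 0 < δ ∧ ∀ u, |u - t| < δ → |f u - f t| < s :=
  (nhds_basis_abs_sub_lt t).tendsto_iff (nhds_basis_abs_sub_lt (f t))

theorem eventually_continuousAt_of_bounded (hF : ExpandsOrderedField L F)
    (hc : DefinablyComplete L F) (homin : LocallyOMinimal L F) {f : F → F}
    (hf : DefFun L (fun v : Unit → F => f (v ()))) {p N : F}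
    (hN : ∀ᶠ t in 𝓝[>] p, |f t| ≤ N) : ∀ᶠ t in 𝓝[>] p, ContinuousAt f t := by
  have hlt : Def L {v : Fin 2 → F | ∃ δ, 0 < δ ∧ ∀ u, |u - v 1| < δ →
      |f u - f (v 1)| < v 0} :=
    Def.ex (Def.and (Def.lt hF (DefFun.const _) (DefFun.var _)) (Def.all (Def.imp
      (Def.lt hF (DefFun.abs hF (DefFun.sub hF (DefFun.var _) (DefFun.var _))) (DefFun.var _))
      (Def.lt hF (DefFun.abs hF (DefFun.sub hF (hf.comp₁ (DefFun.var _))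
        (hf.comp₁ (DefFun.var _)))) (DefFun.var _)))))
  have hcont : Def L {v : Unit → F | ContinuousAt f (v ())} := by
    simp only [continuousAt_iff_forall_abs]
    refine Def.all (Def.imp (Def.lt hF (DefFun.const _) (DefFun.var _)) ?_)
    exact Def.app₂ (P := fun s t => ∃ δ, 0 < δ ∧ ∀ u, |u - t| < δ → |f u - f t| < s) hlt
      (DefFun.var _) (DefFun.var _)
  refine (eventually_or_not homin hcont p).resolve_right fun hdisc => ?_
  obtain ⟨d, hpd, hd⟩ := eventually_nhdsGT_iff.mp (hN.and hdisc)
  -- If `f` were discontinuous throughout `(p, d)`, the sets of points where continuity fails for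
  -- the tolerance `s` would cover it. Right limits of `f` prevent each of them from accumulating
  -- from the right.
  refine not_forall_exists_of_not_accumulating hF hc homin
    (E := fun s t => ¬ ∃ δ, 0 < δ ∧ ∀ u, |u - t| < δ → |f u - f t| < s) hlt.not ?_ hpd ?_ ?_
  · rintro s s' t - hss' h ⟨δ, hδ, h'⟩
    exact h ⟨δ, hδ, fun u hu => (h' u hu).trans_le hss'⟩
  · intro s hs q hq
    have hNq : ∀ᶠ t in 𝓝[>] q, |f t| ≤ N := by
      filter_upwards [Ioo_mem_nhdsGT hq.2] with t ht
      exact (hd t (hq.1.trans_lt ht.1) ht.2).1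
    obtain ⟨l, hl⟩ := exists_tendsto_nhdsGT hF hc homin hf hNq
    have := hl.eventually ((nhds_basis_abs_sub_lt l).mem_of_mem (half_pos hs))
    obtain ⟨b, hb, hb'⟩ := eventually_nhdsGT_iff.mp this
    filter_upwards [Ioo_mem_nhdsGT hb] with t ht hn
    -- This radius keeps `u` in `(q, b)`, where `f` is within `s / 2` of `l`.
    refine hn ⟨min (t - q) (b - t), lt_min (sub_pos.mpr ht.1) (sub_pos.mpr ht.2), fun u hu => ?_⟩
    obtain ⟨hu1, hu2⟩ := lt_min_iff.mp hu
    have h1 : |f u - l| < s / 2 := hb' u (by linarith [(abs_lt.mp hu1).1])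
      (by linarith [(abs_lt.mp hu2).2])
    have h2 : |f t - l| < s / 2 := hb' t ht.1 ht.2
    rw [abs_lt] at h1 h2 ⊢
    constructor <;> linarith [h1.1, h1.2, h2.1, h2.2]
  · intro t ht
    have := (hd t ht.1 ht.2).2
    rw [continuousAt_iff_forall_abs] at this
    push Not at this ⊢
    exact this

/-- By the dichotomy `f` or its inverse is bounded by `1` just to the right of `p`. -/
theorem eventually_continuousAt (hF : ExpandsOrderedField L F)
    (hc : DefinablyComplete L F) (homin : LocallyOMinimal L F) {f : F → F}
    (hf : DefFun L (fun v : Unit → F => f (v ()))) (p : F) :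
    ∀ᶠ t in 𝓝[>] p, ContinuousAt f t := by
  rcases eventually_or_not homin (P := fun t => |f t| ≤ 1)
    (Def.le hF (DefFun.abs hF hf) (DefFun.const 1)) p with h | h
  · exact eventually_continuousAt_of_bounded hF hc homin hf h
  · have hb : ∀ᶠ t in 𝓝[>] p, |(f t)⁻¹| ≤ 1 := h.mono fun t ht => by
      rw [abs_inv]
      exact inv_le_one_of_one_le₀ (not_le.mp ht).le
    filter_upwards [h, eventually_continuousAt_of_bounded hF hc homin
      (f := fun t => (f t)⁻¹) (DefFun.inv hF hf) hb] with t ht hct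
    have h0 : (f t)⁻¹ ≠ 0 := by
      intro h0
      rw [inv_eq_zero] at h0
      simp [h0] at ht
    have := hct.inv₀ h0
    rwa [show (fun t => (f t)⁻¹)⁻¹ = f from funext fun t => inv_inv (f t)] at this

open Classical in
theorem exists_defFun_choice₁ (hF : ExpandsOrderedField L F) (hc : DefinablyComplete L F)
    (homin : LocallyOMinimal L F) {ι : Type*} [Finite ι] {Q : (ι → F) → F → Prop}
    (hQ : Def L {v : Option ι → F | Q (fun i => v (some i)) (v none)}) :
    ∃ c : (ι → F) → F, DefFun L c ∧ ∀ v x, Q v x → Q v (c v) := by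
  -- Nonnegative solutions are bounded below. Choose their infimum `a` if it solves `Q`; otherwise
  -- `Q` holds on an interval `(a, a + d)` by the dichotomy, and its midpoint is chosen.
  have pos : ∀ Q : (ι → F) → F → Prop,
      Def L {v : Option ι → F | Q (fun i => v (some i)) (v none)} →
      ∃ c : (ι → F) → F, DefFun L c ∧ ∀ v x, 0 ≤ x → Q v x → Q v (c v) := by
    intro Q hQ
    obtain ⟨a, ha, ha'⟩ := exists_defFun_isGLB hF hc (Q := fun v x => 0 ≤ x ∧ Q v x)
      (Def.and (Def.le hF (DefFun.const _) (DefFun.var _)) hQ)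
    -- Including `1` makes the set nonempty, so that its infimum exists even if `Q` never fails
    -- beyond `a`.
    obtain ⟨d, hd, hd'⟩ := exists_defFun_isGLB hF hc
      (Q := fun v x => x = 1 ∨ (0 < x ∧ ¬ Q v (a v + x)))
      (Def.or (Def.eq (DefFun.var _) (DefFun.const _)) (Def.and
        (Def.lt hF (DefFun.const _) (DefFun.var _))
        (Def.app hQ (fun k => DefFun.var _) (DefFun.add hF ha.lift (DefFun.var _))).not))
    refine ⟨fun v => if Q v (a v) then a v else a v + d v * 2⁻¹,
      DefFun.ite (Def.app hQ (fun k => DefFun.var _) ha) ha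
        (DefFun.add hF ha (DefFun.mul hF hd (DefFun.const _))), fun v x hx hxQ => ?_⟩
    by_cases hav : Q v (a v)
    · simp only [hav, if_true]
    · simp only [hav, if_false]
      have hglb := ha' v ⟨x, hx, hxQ⟩ ⟨0, fun y hy => hy.1⟩
      have hglbd := hd' v ⟨1, Or.inl rfl⟩ ⟨0, fun y hy => hy.elim (fun h => h ▸ zero_le_one)
        fun h => h.1.le⟩
      have hev : ∀ᶠ t in 𝓝[>] (a v), Q v t := by
        refine (eventually_or_not homin (P := Q v)
          (Def.app hQ (fun k => DefFun.const _) (DefFun.var _)) (a v)).resolve_right fun h => ?_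
        obtain ⟨b, hb, hb'⟩ := eventually_nhdsGT_iff.mp h
        obtain ⟨t, ht, htb⟩ := (isGLB_lt_iff hglb).mp hb
        refine hb' t ((hglb.1 ht).lt_of_ne ?_) htb ht.2
        rintro h
        exact hav (h ▸ ht.2)
      obtain ⟨b, hb, hb'⟩ := eventually_nhdsGT_iff.mp hev
      have hdpos : 0 < d v := by
        refine (lt_min one_pos (sub_pos.mpr hb)).trans_le (hglbd.2 ?_)
        rintro y (rfl | ⟨hy, hyQ⟩)
        · exact min_le_left _ _
        · refine (min_le_right _ _).trans ?_
          by_contra hlt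
          exact hyQ (hb' _ (by linarith) (by linarith [not_le.mp hlt]))
      by_contra hn
      have := hglbd.1 (Or.inr ⟨mul_pos hdpos (by positivity), hn⟩)
      have h2 : d v * 2⁻¹ < d v := by
        rw [← div_eq_mul_inv]
        exact half_lt_self hdpos
      exact not_le.mpr h2 this
  obtain ⟨c₁, hc₁, hc₁'⟩ := pos Q hQ
  obtain ⟨c₂, hc₂, hc₂'⟩ := pos (fun v x => Q v (-x))
    (Def.app hQ (fun k => DefFun.var _) (DefFun.neg hF (DefFun.var _)))
  refine ⟨fun v => if Q v (c₁ v) then c₁ v else - c₂ v,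
    DefFun.ite (Def.app hQ (fun k => DefFun.var _) hc₁) hc₁ (DefFun.neg hF hc₂),
    fun v x hx => ?_⟩
  by_cases h : Q v (c₁ v)
  · simp only [h, if_true]
  · simp only [h, if_false]
    rcases le_total 0 x with h0 | h0
    · exact absurd (hc₁' v x h0 hx) h
    · exact hc₂' v (-x) (neg_nonneg.mpr h0) (by simpa using hx)

/-- Choose a first coordinate that extends to a solution, then the remaining ones by induction. -/
theorem exists_defFun_choice (hF : ExpandsOrderedField L F) (hc : DefinablyComplete L F)
    (homin : LocallyOMinimal L F) {ι : Type*} [Finite ι] {k : ℕ}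
    {P : (ι → F) → (Fin k → F) → Prop}
    (hP : Def L {v : ι ⊕ Fin k → F | P (fun i => v (Sum.inl i)) (fun j => v (Sum.inr j))}) :
    ∃ g : (ι → F) → Fin k → F, (∀ j, DefFun L (fun v => g v j)) ∧
      ∀ v w, P v w → P v (g v) := by
  induction k with
  | zero =>
    exact ⟨fun _ => Fin.elim0, fun j => j.elim0, fun v w h => by rwa [Subsingleton.elim w] at h⟩
  | succ k ih =>
    have happ : ∀ {μ : Type _} [Finite μ] {a : ι → (μ → F) → F} {b : (μ → F) → F}
        {e : Fin k → (μ → F) → F}, (∀ i, DefFun L (a i)) → DefFun L b → (∀ j, DefFun L (e j)) →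
        Def L {v | P (fun i => a i v) (Fin.cons (b v) (fun j => e j v))} := by
      intro μ _ a b e ha hb he
      have := hP.subst (g := Sum.elim a (Fin.cons b e : Fin (k + 1) → (μ → F) → F)) (by
        rintro (i | j)
        · exact ha i
        · exact Fin.cases hb he j)
      refine (congrArg (Def L) ?_).mp this
      ext v
      have : (fun j => (Fin.cons b e : Fin (k + 1) → (μ → F) → F) j v) =
          (Fin.cons (b v) (fun j => e j v) : Fin (k + 1) → F) := by
        ext j
        exact Fin.cases rfl (fun _ => rfl) j
      simp only [mem_ofPred_eq, Sum.elim_inl, Sum.elim_inr, this]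
    obtain ⟨c, hc1, hc2⟩ := exists_defFun_choice₁ hF hc homin
      (Q := fun v x => ∃ w : Fin k → F, P v (Fin.cons x w))
      (Def.exVec (happ (fun _ => DefFun.var _) (DefFun.var _) (fun _ => DefFun.var _)))
    obtain ⟨g, hg1, hg2⟩ := ih (P := fun v w => P v (Fin.cons (c v) w))
      (happ (fun _ => DefFun.var _) (hc1.reindex _) (fun _ => DefFun.var _))
    refine ⟨fun v => Fin.cons (c v) (g v), fun j => Fin.cases hc1 hg1 j, fun v w hw => ?_⟩
    obtain ⟨w', hw'⟩ := hc2 v (w 0) ⟨Fin.tail w, by rwa [Fin.cons_self_tail]⟩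
    exact hg2 v w' hw'

end Topology

end DefinablyComplete

/-! ### Curve selection -/

section Curves

variable {F : Type w} [Field F] [LinearOrder F] [IsStrictOrderedRing F]
  [TopologicalSpace F] [OrderTopology F]

theorem nhds_pi_basis_abs_sub_lt {ι : Type*} [Finite ι] (x : ι → F) :
    (𝓝 x).HasBasis (fun s : F => 0 < s) (fun s => {y | ∀ i, |y i - x i| < s}) := by
  rw [nhds_pi]
  refine (Filter.hasBasis_pi fun i => nhds_basis_abs_sub_lt (x i)).to_hasBasis ?_ ?_
  · rintro ⟨I, f⟩ ⟨hI, hf⟩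
    have h : ∀ᶠ s : F in 𝓝[>] 0, ∀ i ∈ I, s < f i := by
      rw [Filter.eventually_all_finite hI]
      exact fun i hi => (eventually_mem_Ioo (hf i hi)).mono fun s hs => hs.2
    obtain ⟨s, hs, hs0⟩ := (h.and self_mem_nhdsWithin).exists
    exact ⟨s, hs0, fun y hy i hi => (hy i).trans (hs i hi)⟩
  · intro s hs
    exact ⟨(univ, fun _ => s), ⟨finite_univ, fun _ _ => hs⟩, fun y hy i => hy i (mem_univ i)⟩

theorem mem_closure_iff_forall_abs {ι : Type*} [Finite ι] {A : Set (ι → F)} {x : ι → F} :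
    x ∈ closure A ↔ ∀ s, 0 < s → ∃ y, y ∈ A ∧ ∀ i, |y i - x i| < s :=
  mem_closure_iff_nhds_basis (nhds_pi_basis_abs_sub_lt x)

variable {L : FirstOrder.Language.{u, v}} [L.Structure F]

theorem Def.closure (hF : ExpandsOrderedField L F) {ι : Type*} [Finite ι] {A : Set (ι → F)}
    (hA : Def L A) : Def L (closure A) := by
  have h : Def L {x : ι → F | ∀ s, 0 < s → ∃ y : ι → F, y ∈ A ∧ ∀ i, |y i - x i| < s} :=
    Def.all (Def.imp (Def.lt hF (DefFun.const _) (DefFun.var _)) (Def.exVec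
      (Def.and (hA.reindex _) (Def.finAll fun i => Def.lt hF
        (DefFun.abs hF (DefFun.sub hF (DefFun.var _) (DefFun.var _))) (DefFun.var _)))))
  refine (congrArg (Def L) ?_).mp h
  ext x
  exact mem_closure_iff_forall_abs.symm

theorem exists_curve (hF : ExpandsOrderedField L F) (hc : DefinablyComplete L F)
    (homin : LocallyOMinimal L F) {k : ℕ} {P : F → (Fin k → F) → Prop}
    (hP : Def L {v : Unit ⊕ Fin k → F | P (v (Sum.inl ())) (fun j => v (Sum.inr j))})
    (hex : ∀ᶠ t in 𝓝[>] (0 : F), ∃ w, P t w) :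
    ∃ γ : F → Fin k → F, (∀ j, DefFun L (fun v : Unit → F => γ (v ()) j)) ∧
      ∀ᶠ t in 𝓝[>] (0 : F), P t (γ t) ∧ ContinuousAt γ t := by
  obtain ⟨g, hg1, hg2⟩ := exists_defFun_choice hF hc homin (ι := Unit)
    (P := fun v w => P (v ()) w) hP
  refine ⟨fun t => g fun _ => t, hg1, ?_⟩
  have hcont : ∀ᶠ t in 𝓝[>] (0 : F), ∀ j, ContinuousAt (fun t => g (fun _ => t) j) t :=
    Filter.eventually_all.mpr fun j => eventually_continuousAt hF hc homin (hg1 j) 0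
  filter_upwards [hex, hcont] with t ⟨w, hw⟩ ht
  exact ⟨hg2 (fun _ => t) w hw, continuousAt_pi.mpr ht⟩

theorem DefCurve.of_eventually (hF : ExpandsOrderedField L F) {ι : Type*} [Finite ι]
    {A : Set (ι → F)} {γ : F → ι → F} (hγ : ∀ j, DefFun L (fun v : Unit → F => γ (v ()) j))
    (h : ∀ᶠ t in 𝓝[>] (0 : F), γ t ∈ A ∧ ContinuousAt γ t) : ∃ ε, DefCurve L A ε γ := by
  obtain ⟨ε, hε, h⟩ := eventually_nhdsGT_iff.mp h
  refine ⟨ε, hε, fun t ht => (h t ht.1 ht.2).1,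
    fun t ht => (h t ht.1 ht.2).2.continuousWithinAt, ?_⟩
  refine Def.and (Def.and (Def.lt hF (DefFun.const _) (DefFun.var _))
    (Def.lt hF (DefFun.var _) (DefFun.const _))) ?_
  simp only [funext_iff]
  exact Def.finAll fun j => Def.eq (DefFun.var (Sum.inr j)) 
    (DefFun.comp₁ (f := fun t => γ t j) (hγ j) (DefFun.var _))

/-- A bounded definable map has a limit at `0` from the right. -/
theorem exists_curveLim (hF : ExpandsOrderedField L F) (hc : DefinablyComplete L F)
    (homin : LocallyOMinimal L F) {ι : Type*} [Finite ι] {γ : F → ι → F}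
    (hγ : ∀ j, DefFun L (fun v : Unit → F => γ (v ()) j)) {N : F}
    (hN : ∀ᶠ t in 𝓝[>] (0 : F), ∀ j, |γ t j| ≤ N) : ∃ x, CurveLim γ x := by
  have h := fun j => exists_tendsto_nhdsGT hF hc homin (hγ j) (hN.mono fun t ht => ht j)
  choose x hx using h
  exact ⟨x, tendsto_pi_nhds.mpr hx⟩

end Curves

/-! ### Nearly minimal points of fibres -/

section NearlyMinimal

variable {F : Type w} {ι κ : Type*}

theorem elim_proj (z : ι ⊕ κ → F) : Sum.elim (proj₁ z) (proj₂ z) = z :=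
  Sum.elim_comp_inl_inr z

theorem mem_image_proj₂_fibre {Z : Set (ι ⊕ κ → F)} {y : ι → F} {x : κ → F} :
    x ∈ proj₂ '' (Z ∩ proj₁ ⁻¹' {y}) ↔ Sum.elim y x ∈ Z := by
  constructor
  · rintro ⟨z, ⟨hz, rfl⟩, rfl⟩
    rwa [elim_proj]
  · exact fun h => ⟨_, ⟨h, Sum.elim_comp_inl y x⟩, Sum.elim_comp_inr y x⟩

variable [Field F] [LinearOrder F]

/-- The points of `F ^ κ` that lie in the fibre of `Z` over some `y` and whose maximum norm exceeds
that of any other point of this fibre by at most `1`. -/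
def nearlyMinimal (Z : Set (ι ⊕ κ → F)) : Set (κ → F) :=
  {x | ∃ y : ι → F, Sum.elim y x ∈ Z ∧ ∀ x' : κ → F, Sum.elim y x' ∈ Z →
    ∀ r, 0 ≤ r → (∀ i, |x' i| ≤ r) → ∀ i, |x i| ≤ r + 1}

theorem exists_bound [IsStrictOrderedRing F] [Finite κ] (x : κ → F) :
    ∃ r, 0 ≤ r ∧ ∀ i, |x i| ≤ r := by
  have := Fintype.ofFinite κ
  exact ⟨∑ i, |x i|, Finset.sum_nonneg fun i _ => abs_nonneg _,
    fun i => Finset.single_le_sum (fun j _ => abs_nonneg (x j)) (Finset.mem_univ i)⟩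

variable {L : FirstOrder.Language.{u, v}} [L.Structure F] [IsStrictOrderedRing F] [Finite ι]
  [Finite κ]

theorem Def.bound (hF : ExpandsOrderedField L F) {f : κ → (ι → F) → F} {r : (ι → F) → F}
    (hf : ∀ k, DefFun L (f k)) (hr : DefFun L r) : Def L {v | ∀ k, |f k v| ≤ r v} :=
  Def.finAll fun k => Def.le hF (DefFun.abs hF (hf k)) hr

theorem def_nearlyMinimal (hF : ExpandsOrderedField L F) {Z : Set (ι ⊕ κ → F)} (hZ : Def L Z) :
    Def L (nearlyMinimal Z) := by
  refine Def.exVec (Def.and (hZ.subst_elim (fun _ => DefFun.var _) fun _ => DefFun.var _)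
    (Def.allVec (Def.imp (hZ.subst_elim (fun _ => DefFun.var _) fun _ => DefFun.var _)
    (Def.all (Def.imp (Def.le hF (DefFun.const _) (DefFun.var _)) (Def.imp
    (Def.bound hF (fun _ => DefFun.var _) (DefFun.var _))
    (Def.bound hF (fun _ => DefFun.var _) (DefFun.add hF (DefFun.var _) (DefFun.const _)))))))))

/-- The slack `1` makes it unnecessary for the infimum `a` of the norms to be attained: any point of
norm below `a + 1` serves. -/
theorem exists_mem_nearlyMinimal (hF : ExpandsOrderedField L F) (hc : DefinablyComplete L F)
    {Z : Set (ι ⊕ κ → F)} (hZ : Def L Z) {y : ι → F} {x₀ : κ → F} (h₀ : Sum.elim y x₀ ∈ Z) :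
    ∃ x ∈ nearlyMinimal Z, Sum.elim y x ∈ Z := by
  have hS : Def L {v : Unit → F | 0 ≤ v () ∧ ∃ x : κ → F, Sum.elim y x ∈ Z ∧
      ∀ i, |x i| ≤ v ()} :=
    Def.and (Def.le hF (DefFun.const _) (DefFun.var _)) (Def.exVec (Def.and
      (hZ.subst_elim (fun k => DefFun.const (y k)) fun _ => DefFun.var _)
      (Def.bound hF (fun _ => DefFun.var _) (DefFun.var _))))
  obtain ⟨r₀, hr₀, hb₀⟩ := exists_bound x₀
  obtain ⟨a, ha⟩ := hc.exists_inf _ (Def.definable₁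
    (P := fun r => 0 ≤ r ∧ ∃ x : κ → F, Sum.elim y x ∈ Z ∧ ∀ i, |x i| ≤ r) hS)
    ⟨r₀, hr₀, x₀, h₀, hb₀⟩ ⟨0, fun r hr => hr.1⟩
  obtain ⟨r, ⟨-, x, hx, hxr⟩, hr⟩ := (isGLB_lt_iff ha).mp (lt_add_one a)
  refine ⟨x, ⟨y, hx, fun x' hx' r' hr' hb i => (hxr i).trans ?_⟩, hx⟩
  have := ha.1 ⟨hr', x', hx', hb⟩
  linarith

end NearlyMinimal

end LocOMin

/-! ### Fibres far out, and the main theorem -/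

open LocOMin in
/-- Near a point of `Z` whose second coordinate is far out in the closure of the nearly minimal
points there are fibres all of whose points are far out. -/
theorem LocOMin.exists_fibre_far_out {L : FirstOrder.Language.{u, v}} {F : Type w} [Field F]
    [LinearOrder F] [IsStrictOrderedRing F] [TopologicalSpace F] [OrderTopology F] [L.Structure F]
    (hF : ExpandsOrderedField L F) (hcomplete : DefinablyComplete L F)
    (homin : LocallyOMinimal L F) {m n : ℕ} {X : Set (Fin m → F)} {Y : Set (Fin n → F)}
    {Z : Set (Fin n ⊕ Fin m → F)} (hZ : Def L Z) (hZsub : Z ⊆ prodSet Y X)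
    (h2 : ∀ y₁ ∈ Y, ∀ y₂ ∈ Y,
      (proj₂ '' (Z ∩ proj₁ ⁻¹' {y₁}) = proj₂ '' (Z ∩ proj₁ ⁻¹' {y₂})) ∨
      (proj₂ '' (Z ∩ proj₁ ⁻¹' {y₁})) ∩ (proj₂ '' (Z ∩ proj₁ ⁻¹' {y₂})) = ∅)
    (h5 : ∀ (ε : F) (β : F → Fin m → F) (x : Fin m → F) (y : Fin n → F),
      DefCurve L X ε β → x ∈ X → CurveLim β x → y ∈ Y → Sum.elim y x ∈ Z →
      ∃ (δ : F) (α : F → Fin n ⊕ Fin m → F), 0 < δ ∧ δ ≤ ε ∧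
        DefCurve L Z δ α ∧ CurveLim α (Sum.elim y x) ∧ ∀ t ∈ Ioo 0 δ, proj₂ (α t) = β t)
    {y : Fin n → F} {x : Fin m → F} (hyx : Sum.elim y x ∈ Z)
    (hx : x ∈ closure (nearlyMinimal Z)) {N s : F} (hs : 0 < s) (hN : ¬ ∀ i, |x i| ≤ N) :
    ∃ y' ∈ Y, (∀ i, |y' i - y i| < s) ∧
      ∀ x', Sum.elim y' x' ∈ Z → ∀ r, 0 ≤ r → r + 2 ≤ N → ¬ ∀ i, |x' i| ≤ r := by
  have hYX : ∀ {a b}, Sum.elim a b ∈ Z → a ∈ Y ∧ b ∈ X := fun h => hZsub h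
  obtain ⟨β, hβ1, hβ2⟩ := exists_curve hF hcomplete homin
    (P := fun t w => w ∈ nearlyMinimal Z ∧ ∀ i, |w i - x i| < t)
    (Def.and ((def_nearlyMinimal hF hZ).reindex _) (Def.finAll fun i => Def.lt hF
      (DefFun.abs hF (DefFun.sub hF (DefFun.var _) (DefFun.const _))) (DefFun.var _)))
    (by
      filter_upwards [self_mem_nhdsWithin] with t ht
      exact mem_closure_iff_forall_abs.mp hx t ht)
  obtain ⟨ε, hε⟩ := DefCurve.of_eventually hF (A := X) hβ1 (hβ2.mono fun t ht => by
    obtain ⟨⟨⟨y', hy', -⟩, -⟩, hcont⟩ := ht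
    exact ⟨(hYX hy').2, hcont⟩)
  have hlim : CurveLim β x := by
    refine (nhds_pi_basis_abs_sub_lt x).tendsto_right_iff.mpr fun r hr => ?_
    filter_upwards [hβ2, Ioo_mem_nhdsGT hr] with t ht htr i
    exact (ht.1.2 i).trans htr.2
  obtain ⟨δ, α, hδ, -, hα, hαlim, hαβ⟩ := h5 ε β x y hε (hYX hyx).2 hlim (hYX hyx).1 hyx
  have hα' := (nhds_pi_basis_abs_sub_lt _).tendsto_right_iff.mp hαlim s hs
  obtain ⟨t, hts, ht1, htδ, htβ⟩ := (hα'.and ((eventually_mem_Ioo (one_pos : (0 : F) < 1)).and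
    ((eventually_mem_Ioo hδ).and hβ2))).exists
  have hmem : Sum.elim (proj₁ (α t)) (β t) ∈ Z := by
    rw [← hαβ t htδ, elim_proj]
    exact hα.mapsTo htδ
  refine ⟨proj₁ (α t), (hYX hmem).1, fun i => hts (Sum.inl i), fun x' hx' r hr hrN hb => hN ?_⟩
  obtain ⟨⟨⟨y'', hy'', hmin⟩, hβx⟩, -⟩ := htβ
  -- The two fibres share `β t`, so (2) makes them equal, and near minimality of `β t` over `y''`
  -- transfers to `proj₁ (α t)`.
  have hfib : proj₂ '' (Z ∩ proj₁ ⁻¹' {proj₁ (α t)}) = proj₂ '' (Z ∩ proj₁ ⁻¹' {y''}) := by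
    refine (h2 _ (hYX hmem).1 _ (hYX hy'').1).resolve_right fun h => ?_
    exact (h ▸ ⟨mem_image_proj₂_fibre.mpr hmem, mem_image_proj₂_fibre.mpr hy''⟩ :
      β t ∈ (∅ : Set (Fin m → F)))
  have hx'' : Sum.elim y'' x' ∈ Z :=
    mem_image_proj₂_fibre.mp (hfib ▸ mem_image_proj₂_fibre.mpr hx')
  -- The `2` in `r + 2 ≤ N` is the slack `1` of near minimality plus the distance `t < 1` from `β t`
  -- to `x`.
  intro i
  have e1 := hmin x' hx'' r hr hb i
  have e2 := (hβx i).trans ht1.2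
  have e3 := abs_sub_abs_le_abs_sub (x i) (β t i)
  rw [abs_sub_comm] at e3
  linarith

theorem mainTheorem6 {L : FirstOrder.Language.{u, v}} {F : Type w} [Field F] [LinearOrder F]
    [IsStrictOrderedRing F] [TopologicalSpace F] [OrderTopology F] [L.Structure F]
    (hF : LocOMin.ExpandsOrderedField L F)
    (hcomplete : LocOMin.DefinablyComplete L F)
    (homin : LocOMin.LocallyOMinimal L F)
    (m n : ℕ) (X : Set (Fin m → F)) (Y : Set (Fin n → F)) (Z : Set (Fin n ⊕ Fin m → F))
    (hX : LocOMin.Def L X) (hY : LocOMin.Def L Y) (hZ : LocOMin.Def L Z)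
    (hZsub : Z ⊆ LocOMin.prodSet Y X)
    -- (1)
    (h1 : SurjOn LocOMin.proj₁ Z Y)
    -- (2)
    (h2 : ∀ y₁ ∈ Y, ∀ y₂ ∈ Y,
      (LocOMin.proj₂ '' (Z ∩ LocOMin.proj₁ ⁻¹' {y₁})
        = LocOMin.proj₂ '' (Z ∩ LocOMin.proj₁ ⁻¹' {y₂})) ∨
      (LocOMin.proj₂ '' (Z ∩ LocOMin.proj₁ ⁻¹' {y₁}))
        ∩ (LocOMin.proj₂ '' (Z ∩ LocOMin.proj₁ ⁻¹' {y₂})) = ∅)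
    -- (3)
    (h3X : IsClosed X) (h3Z : LocOMin.ClosedIn Z (LocOMin.prodSet Y X))
    -- (4)
    (h4 : ∀ (ε : F) (γ : F → Fin n → F),
      LocOMin.DefCurve L Y ε γ → LocOMin.Completable Y γ →
      ∃ (δ : F) (α : F → Fin n ⊕ Fin m → F), 0 < δ ∧ δ ≤ ε ∧
        LocOMin.DefCurve L Z δ α ∧ LocOMin.Completable Z α ∧
        ∀ t ∈ Ioo 0 δ, LocOMin.proj₁ (α t) = γ t)
    -- (5)
    (h5 : ∀ (ε : F) (β : F → Fin m → F) (x : Fin m → F) (y : Fin n → F),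
      LocOMin.DefCurve L X ε β → x ∈ X → LocOMin.CurveLim β x →
      y ∈ Y → Sum.elim y x ∈ Z →
      ∃ (δ : F) (α : F → Fin n ⊕ Fin m → F), 0 < δ ∧ δ ≤ ε ∧
        LocOMin.DefCurve L Z δ α ∧ LocOMin.CurveLim α (Sum.elim y x) ∧
        ∀ t ∈ Ioo 0 δ, LocOMin.proj₂ (α t) = β t) :
    ∃ K : Set (Fin m → F), K ⊆ X ∧ LocOMin.Def L K ∧ IsClosed K ∧
      SurjOn LocOMin.proj₁ (Z ∩ LocOMin.proj₂ ⁻¹' K) Y ∧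
      LocOMin.DefProper L (Z ∩ LocOMin.proj₂ ⁻¹' K) Y LocOMin.proj₁ := by
  open LocOMin in
  have hYX : ∀ {a b}, Sum.elim a b ∈ Z → a ∈ Y ∧ b ∈ X := fun h => hZsub h
  have hKX : closure (nearlyMinimal Z) ⊆ X :=
    h3X.closure_subset_iff.mpr fun x ⟨y, hy, _⟩ => (hYX hy).2
  have hKdef : Def L (closure (nearlyMinimal Z)) := Def.closure hF (def_nearlyMinimal hF hZ)
  have hp₁ : Continuous (proj₁ : (Fin n ⊕ Fin m → F) → Fin n → F) :=
    continuous_pi fun i => continuous_apply (Sum.inl i)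
  have hp₂ : Continuous (proj₂ : (Fin n ⊕ Fin m → F) → Fin m → F) :=
    continuous_pi fun i => continuous_apply (Sum.inr i)
  refine ⟨closure (nearlyMinimal Z), hKX, hKdef, isClosed_closure, ?_, ⟨fun z hz => (hZsub hz.1).1,
    ?_⟩, hp₁.continuousOn, fun C hC hCcl hCb hCY => ⟨?_, ?_⟩⟩
  · intro y hy
    obtain ⟨z, hz, rfl⟩ := h1 hy
    obtain ⟨x, hx, hyx⟩ := exists_mem_nearlyMinimal hF hcomplete hZ (y := proj₁ z)
      (x₀ := proj₂ z) (by rwa [elim_proj])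
    exact ⟨_, ⟨hyx, subset_closure hx⟩, rfl⟩
  · refine Def.and (Def.and (hZ.reindex _) (hKdef.reindex _)) ?_
    simp only [funext_iff]
    exact Def.finAll fun j => Def.eq (DefFun.var (Sum.inr j)) (DefFun.var (Sum.inl (Sum.inl j)))
  · obtain ⟨D, hD, rfl⟩ := h3Z
    -- As `C ⊆ Y` and `K ⊆ X`, the factor `prodSet Y X` can be dropped.
    refine (congrArg IsClosed ?_).mp
      (hD.inter (((isClosed_closure (s := nearlyMinimal (prodSet Y X ∩ D))).preimage hp₂).inter (hCcl.preimage hp₁)))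
    ext z
    exact ⟨fun h => ⟨⟨⟨⟨hCY h.2.2, hKX h.2.1⟩, h.1⟩, h.2.1⟩, h.2.2⟩,
      fun h => ⟨h.1.1.2, h.1.2, h.2⟩⟩
  · obtain ⟨N₀, hN₀⟩ := hCb
    by_contra hunb
    have hfar : ∀ N : F, ∃ y x, y ∈ C ∧ Sum.elim y x ∈ Z ∧ x ∈ closure (nearlyMinimal Z) ∧
        ¬ ∀ i, |x i| ≤ N := by
      intro N
      by_contra! hN
      refine hunb ⟨max N₀ N, ?_⟩
      rintro z ⟨⟨hz, hzK⟩, hzC⟩ (i | i)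
      · exact (hN₀ _ hzC i).trans (le_max_left _ _)
      · exact (hN (proj₁ z) (proj₂ z) hzC (by rwa [elim_proj]) hzK i).trans (le_max_right _ _)
    -- At parameter `s` the bound is `N = 1 / s`; `(r + 2) * s ≤ 1` is `r + 2 ≤ N` without division.
    obtain ⟨γ, hγ1, hγ2⟩ := exists_curve hF hcomplete homin (k := n)
      (P := fun s y' => y' ∈ Y ∧ (∃ y : Fin n → F, y ∈ C ∧ ∀ i, |y' i - y i| < s) ∧
        ∀ x' : Fin m → F, Sum.elim y' x' ∈ Z → ∀ r, 0 ≤ r → (r + 2) * s ≤ 1 →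
          ¬ ∀ i, |x' i| ≤ r)
      (by
        refine Def.and (hY.reindex _) (Def.and (Def.exVec (Def.and (hC.reindex _)
          (Def.finAll fun i => Def.lt hF (DefFun.abs hF (DefFun.sub hF (DefFun.var _)
            (DefFun.var _))) (DefFun.var _)))) (Def.allVec (Def.imp
          (hZ.subst_elim (fun _ => DefFun.var _) fun _ => DefFun.var _) (Def.all (Def.imp
          (Def.le hF (DefFun.const _) (DefFun.var _)) (Def.imp
          (Def.le hF (DefFun.mul hF (DefFun.add hF (DefFun.var _) (DefFun.const _))
            (DefFun.var _)) (DefFun.const _))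
          (Def.bound hF (fun _ => DefFun.var _) (DefFun.var _)).not)))))))
      (by
        filter_upwards [self_mem_nhdsWithin] with s (hs : 0 < s)
        obtain ⟨y, x, hy, hyx, hx, hN⟩ := hfar (1 / s)
        obtain ⟨y', hy', hyy', hfib⟩ :=
          exists_fibre_far_out hF hcomplete homin hZ hZsub h2 h5 hyx hx hs hN
        exact ⟨y', hy', ⟨y, hy, hyy'⟩, fun x' hx' r hr hrs =>
          hfib x' hx' r hr ((le_div_iff₀ hs).mpr hrs)⟩)
    obtain ⟨ε, hε⟩ := DefCurve.of_eventually hF (A := Y) hγ1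
      (hγ2.mono fun t ht => ⟨ht.1.1, ht.2⟩)
    obtain ⟨y₀, hy₀⟩ := exists_curveLim hF hcomplete homin hγ1 (N := N₀ + 1) (by
      filter_upwards [hγ2, Ioo_mem_nhdsGT (one_pos : (0 : F) < 1)] with t ht ht1 j
      obtain ⟨⟨-, ⟨y, hy, hyt⟩, -⟩, -⟩ := ht
      have e1 := hN₀ y hy j
      have e2 := (hyt j).trans ht1.2
      have e3 := abs_sub_abs_le_abs_sub (γ t j) (y j)
      linarith)
    have hy₀C : y₀ ∈ C := by
      rw [← hCcl.closure_eq, mem_closure_iff_forall_abs]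
      intro s hs
      have hlim := (nhds_pi_basis_abs_sub_lt y₀).tendsto_right_iff.mp hy₀ _ (half_pos hs)
      obtain ⟨t, ht1, ht2, ht3⟩ := (hlim.and (hγ2.and (eventually_mem_Ioo (half_pos hs)))).exists
      obtain ⟨⟨-, ⟨y, hy, hyt⟩, -⟩, -⟩ := ht2
      refine ⟨y, hy, fun i => ?_⟩
      have e1 := abs_sub_le (y i) (γ t i) (y₀ i)
      have e2 := hyt i
      have e3 := ht1 i
      have e4 := ht3.2
      rw [abs_sub_comm] at e2
      linarith
    obtain ⟨δ, α, hδ, -, hα, ⟨z₀, -, hz₀⟩, hαγ⟩ := h4 ε γ hε ⟨y₀, hCY hy₀C, hy₀⟩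
    obtain ⟨R, hR, hR'⟩ := exists_bound (proj₂ z₀)
    have hlim := (nhds_pi_basis_abs_sub_lt z₀).tendsto_right_iff.mp hz₀ 1 one_pos
    have hpos : 0 < R + 1 + 2 := by linarith
    -- Near `0` the lift has second coordinate of norm at most `R + 1`, while for `t < 1 / (R + 1 +
    -- 2)` the fibre over `γ t` has no such point.
    obtain ⟨t, ht1, ht2, ht3, ht4⟩ := (hlim.and (hγ2.and ((eventually_mem_Ioo hδ).and
      (eventually_mem_Ioo (one_div_pos.mpr hpos))))).exists
    refine ht2.1.2.2 (proj₂ (α t)) ?_ (R + 1) (by linarith) ?_ fun i => ?_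
    · rw [← hαγ t ht3, elim_proj]
      exact hα.mapsTo ht3
    · rw [mul_comm]
      exact (le_div_iff₀ hpos).mp ht4.2.le
    · have e1 : |proj₂ (α t) i - proj₂ z₀ i| < 1 := ht1 (Sum.inr i)
      have e2 := hR' i
      have e3 := abs_sub_abs_le_abs_sub (proj₂ (α t) i) (proj₂ z₀ i)
      linarith
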